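/- An MV-algebra is an abelian monoid $(A,\oplus,0)$ with a unary operation $\neg$ satisfying $\neg\neg x=x$, $x\oplus\neg 0=\neg 0$ and $x\oplus\neg(x\oplus\neg y)=y\oplus\neg(y\oplus\neg x)$; put $1=\neg 0$, $x\odot y=\neg(\neg x\oplus\neg y)$, $x\vee y=\neg(\neg x\oplus y)\oplus y$ and $x\wedge y=\neg(\neg x\vee\neg y)$. It is semisimple if it is a subdirect product of simple MV-algebras, an MV-algebra being simple if its identity congruence is maximal among proper congruences. The standard MV-algebra $[0,1]$ has $x\oplus y=\min\{x+y,1\}$ and $\neg x=1-x$. The dual of an MV-algebra $A$ is the space $W(A)=\mathrm{Hom}(A,[0,1])$, regarded as a subspace of the Tychonoff cube $[0,1]^A$. A map $\xi\colon[0,1]^I\to[0,1]$ is piecewise linear with integer coefficients if it factors through the projection to $[0,1]^{I'}$ for some finite $I'\subseteq I$ as a continuous map $[0,1]^{I'}\to[0,1]$ that at each point agrees with one of finitely many affine maps $[0,1]^{I'}\to\mathbb R$ with integer coefficients. For $P\subseteq[0,1]^I$ and $Q\subseteq[0,1]^J$, a map $P\to Q$ is a $\mathbb Z$-map if each of its coordinates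 is the restriction to $P$ of such a map $[0,1]^I\to[0,1]$; $P$ and $Q$ are $\mathbb Z$-homeomorphic if there is a homeomorphism $P\to Q$ which is a $\mathbb Z$-map together with its inverse. For MV-algebras $A,B$, the semisimple tensor product $A\otimes B$ is the quotient, by the intersection of all its maximal congruences, of the MV-algebra presented by the generators $A\times B$ and the following relations, for all $a,a_1,a_2\in A$ and $b,b_1,b_2\in B$: 1. $(1,1)=1$, $(a,0)=0$ and $(0,b)=0$; 2. $(a,b_1\vee b_2)=(a,b_1)\vee(a,b_2)$ and $(a,b_1\wedge b_2)=(a,b_1)\wedge(a,b_2)$; 3. $(a,b_1)\odot(a,b_2)=0$ and $(a,b_1\oplus b_2)=(a,b_1)\oplus(a,b_2)$, whenever $b_1\odot b_2=0$; 4. the relations symmetric to those in 2 and 3, in the first variable. Let $A\amalg B$ be the coproduct of $A$ and $B$, taken either in the category of MV-algebras or in the category of semisimple MV-algebras (that is, the former coproduct modulo the intersection of its maximal congruences). **Theorem.** Let $A$ and $B$ be semisimple MV-algebras, and let $\cdot\colon[0,1]^A\times[0,1]^B\to[0,1]^{A\times B}$ be the map $(f\cdot g)(a,b)=f(a)\,g(b)$.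 Then: (i) $W(A\otimes B)\subseteq[0,1]^{A\otimes B}$ is $\mathbb Z$-homeomorphic to $\cdot(W(A)\times W(B))\subseteq[0,1]^{A\times B}$; (ii) for either reading of the coproduct, $W(A\amalg B)\subseteq[0,1]^{A\amalg B}$ is $\mathbb Z$-homeomorphic to $W(A)\times W(B)\subseteq[0,1]^{A}\times[0,1]^{B}=[0,1]^{A\uplus B}$, where $\uplus$ denotes disjoint union; (iii) for either reading of the coproduct, $W(A\otimes B)$ and $W(A\amalg B)$ are homeomorphic. In general, however, the homeomorphism in (iii) cannot be made compatible with the enveloping cubes: there are finite semisimple MV-algebras $A$ and $B$ such that, for both readings of the coproduct, $W(A\otimes B)$ and $W(A\amalg B)$ are not $\mathbb Z$-homeomorphic. -/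

import Mathlib

universe u v

/-! ## MV-algebras -/

/-- An MV-algebra: an abelian monoid `(A, ⊕, 0)` with an operation `¬` such that
`¬¬x = x`, `x ⊕ ¬0 = ¬0` and `x ⊕ ¬(x ⊕ ¬y) = y ⊕ ¬(y ⊕ ¬x)`. -/
class MVAlgebra (A : Type u) where
  zero : A
  oplus : A → A → A
  neg : A → A
  oplus_assoc : ∀ x y z, oplus (oplus x y) z = oplus x (oplus y z)
  oplus_comm : ∀ x y, oplus x y = oplus y x
  oplus_zero : ∀ x, oplus x zero = x
  neg_neg : ∀ x, neg (neg x) = x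
  oplus_neg_zero : ∀ x, oplus x (neg zero) = neg zero
  oplus_neg_oplus : ∀ x y, oplus x (neg (oplus x (neg y))) = oplus y (neg (oplus y (neg x)))

namespace MVAlgebra

/-- `1 = ¬0`. -/
def one {A : Type u} [MVAlgebra A] : A := neg zero

/-- `x ⊙ y = ¬(¬x ⊕ ¬y)`. -/
def odot {A : Type u} [MVAlgebra A] (x y : A) : A := neg (oplus (neg x) (neg y))

/-- `x ∨ y = ¬(¬x ⊕ y) ⊕ y`. -/
def join {A : Type u} [MVAlgebra A] (x y : A) : A := oplus (neg (oplus (neg x) y)) y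

/-- `x ∧ y = ¬(¬x ∨ ¬y)`. -/
def meet {A : Type u} [MVAlgebra A] (x y : A) : A := neg (join (neg x) (neg y))

end MVAlgebra

open MVAlgebra (zero oplus neg one odot join meet)

/-- The standard MV-algebra `[0,1]`: `x ⊕ y = min (x + y) 1`, `¬x = 1 - x`, with neutral
element `0`. -/
noncomputable instance unitInterval.instMVAlgebra : MVAlgebra unitInterval where
  zero := 0
  oplus x y := ⟨min ((x : ℝ) + y) 1,
    le_min (add_nonneg x.2.1 y.2.1) zero_le_one, min_le_right _ _⟩
  neg x := ⟨1 - (x : ℝ), sub_nonneg.2 x.2.2, sub_le_self _ x.2.1⟩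
  oplus_assoc x y z := by
    have hx := x.2.1; have hy := y.2.1; have hz := z.2.1
    apply Subtype.ext
    simp only [min_def]
    split_ifs <;> linarith
  oplus_comm x y := by
    apply Subtype.ext
    simp only [add_comm]
  oplus_zero x := by
    apply Subtype.ext
    simpa using x.2.2
  neg_neg x := by
    apply Subtype.ext
    simp
  oplus_neg_zero x := by
    apply Subtype.ext
    simpa using x.2.1
  oplus_neg_oplus x y := by
    have hx := x.2.1; have hy := y.2.1
    have hx' := x.2.2; have hy' := y.2.2
    apply Subtype.ext
    simp only [min_def]
    split_ifs <;> linarith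

/-- The product of a family of MV-algebras, with pointwise operations. -/
instance Pi.instMVAlgebra {ι : Type v} {S : ι → Type u} [∀ i, MVAlgebra (S i)] :
    MVAlgebra (∀ i, S i) where
  zero := fun _ => zero
  oplus x y := fun i => oplus (x i) (y i)
  neg x := fun i => neg (x i)
  oplus_assoc _ _ _ := funext fun _ => MVAlgebra.oplus_assoc _ _ _
  oplus_comm _ _ := funext fun _ => MVAlgebra.oplus_comm _ _
  oplus_zero _ := funext fun _ => MVAlgebra.oplus_zero _
  neg_neg _ := funext fun _ => MVAlgebra.neg_neg _
  oplus_neg_zero _ := funext fun _ => MVAlgebra.oplus_neg_zero _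
  oplus_neg_oplus _ _ := funext fun _ => MVAlgebra.oplus_neg_oplus _ _

/-- `f` is a homomorphism of MV-algebras. -/
structure IsMVHom {A : Type u} {B : Type v} [MVAlgebra A] [MVAlgebra B] (f : A → B) : Prop where
  map_zero : f zero = zero
  map_oplus : ∀ x y, f (oplus x y) = oplus (f x) (f y)
  map_neg : ∀ x, f (neg x) = neg (f x)

/-! ## Congruences, simple and semisimple algebras -/

/-- A congruence of an MV-algebra. -/
structure MVCon (A : Type u) [MVAlgebra A] extends Setoid A where
  oplus' : ∀ {x x' y y' : A}, r x x' → r y y' → r (oplus x y) (oplus x' y')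
  neg' : ∀ {x x' : A}, r x x' → r (neg x) (neg x')

namespace MVCon

/-- The quotient of an MV-algebra by a congruence. -/
def Quot {A : Type u} [MVAlgebra A] (θ : MVCon A) : Type u := Quotient θ.toSetoid

instance {A : Type u} [MVAlgebra A] (θ : MVCon A) : MVAlgebra θ.Quot where
  zero := Quotient.mk θ.toSetoid zero
  oplus := Quotient.map₂ oplus fun _ _ h _ _ h' => θ.oplus' h h'
  neg := Quotient.map neg fun _ _ h => θ.neg' h
  oplus_assoc x y z := by
    induction x using Quotient.inductionOn
    induction y using Quotient.inductionOn
    induction z using Quotient.inductionOn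
    exact congrArg (Quotient.mk θ.toSetoid) (MVAlgebra.oplus_assoc _ _ _)
  oplus_comm x y := by
    induction x using Quotient.inductionOn
    induction y using Quotient.inductionOn
    exact congrArg (Quotient.mk θ.toSetoid) (MVAlgebra.oplus_comm _ _)
  oplus_zero x := by
    induction x using Quotient.inductionOn
    exact congrArg (Quotient.mk θ.toSetoid) (MVAlgebra.oplus_zero _)
  neg_neg x := by
    induction x using Quotient.inductionOn
    exact congrArg (Quotient.mk θ.toSetoid) (MVAlgebra.neg_neg _)
  oplus_neg_zero x := by
    induction x using Quotient.inductionOn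
    exact congrArg (Quotient.mk θ.toSetoid) (MVAlgebra.oplus_neg_zero _)
  oplus_neg_oplus x y := by
    induction x using Quotient.inductionOn
    induction y using Quotient.inductionOn
    exact congrArg (Quotient.mk θ.toSetoid) (MVAlgebra.oplus_neg_oplus _ _)

/-- A congruence is proper if it does not identify all elements. -/
def IsProper {A : Type u} [MVAlgebra A] (θ : MVCon A) : Prop := ∃ x y, ¬ θ.r x y

/-- A congruence is maximal if it is maximal, for inclusion, among the proper ones. -/
def IsMaximal {A : Type u} [MVAlgebra A] (θ : MVCon A) : Prop :=
  θ.IsProper ∧ ∀ φ : MVCon A, φ.IsProper → (∀ x y, θ.r x y → φ.r x y) →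
    ∀ x y, φ.r x y → θ.r x y

/-- The identity congruence. -/
def idCon (A : Type u) [MVAlgebra A] : MVCon A where
  r x y := x = y
  iseqv := ⟨fun _ => rfl, Eq.symm, Eq.trans⟩
  oplus' := by rintro _ _ _ _ rfl rfl; rfl
  neg' := by rintro _ _ rfl; rfl

/-- The intersection of all maximal congruences. -/
def radical (A : Type u) [MVAlgebra A] : MVCon A where
  r x y := ∀ θ : MVCon A, θ.IsMaximal → θ.r x y
  iseqv := ⟨fun _ θ _ => θ.iseqv.refl _, fun h θ hθ => θ.iseqv.symm (h θ hθ),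
    fun h h' θ hθ => θ.iseqv.trans (h θ hθ) (h' θ hθ)⟩
  oplus' h h' θ hθ := θ.oplus' (h θ hθ) (h' θ hθ)
  neg' h θ hθ := θ.neg' (h θ hθ)

/-- The congruence generated by a set `S` of pairs: the intersection of all congruences
containing `S`. -/
def gen {A : Type u} [MVAlgebra A] (S : Set (A × A)) : MVCon A where
  r x y := ∀ θ : MVCon A, (∀ p ∈ S, θ.r p.1 p.2) → θ.r x y
  iseqv := ⟨fun _ θ _ => θ.iseqv.refl _, fun h θ hθ => θ.iseqv.symm (h θ hθ),
    fun h h' θ hθ => θ.iseqv.trans (h θ hθ) (h' θ hθ)⟩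
  oplus' h h' θ hθ := θ.oplus' (h θ hθ) (h' θ hθ)
  neg' h θ hθ := θ.neg' (h θ hθ)

end MVCon

/-- An MV-algebra is simple if its identity congruence is maximal. -/
def IsSimpleMV (A : Type u) [MVAlgebra A] : Prop := (MVCon.idCon A).IsMaximal

/-- An MV-algebra is semisimple if it is a subdirect product of simple MV-algebras: it embeds in
a product of simple MV-algebras so that every projection stays surjective. -/
def IsSemisimpleMV (A : Type u) [MVAlgebra A] : Prop :=
  ∃ (ι : Type u) (S : ι → Type u) (_ : ∀ i, MVAlgebra (S i)),
    (∀ i, IsSimpleMV (S i)) ∧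
    ∃ f : A → ∀ i, S i, IsMVHom f ∧ Function.Injective f ∧
      ∀ i, Function.Surjective fun a => f a i

/-- The largest semisimple quotient of an MV-algebra: its quotient by the radical. -/
def SemisimpleQuot (A : Type u) [MVAlgebra A] : Type u := (MVCon.radical A).Quot

instance (A : Type u) [MVAlgebra A] : MVAlgebra (SemisimpleQuot A) :=
  inferInstanceAs (MVAlgebra (MVCon.radical A).Quot)

/-! ## Free algebras and presentations -/

/-- Terms in the language of MV-algebras with variables in `X`. -/
inductive MVTerm (X : Type u) : Type u
  | var : X → MVTerm X
  | zero : MVTerm X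
  | oplus : MVTerm X → MVTerm X → MVTerm X
  | neg : MVTerm X → MVTerm X

/-- Two terms are related when their equality is derivable from the axioms of MV-algebras. -/
inductive MVTerm.Rel {X : Type u} : MVTerm X → MVTerm X → Prop
  | refl (x) : Rel x x
  | symm {x y} : Rel x y → Rel y x
  | trans {x y z} : Rel x y → Rel y z → Rel x z
  | oplus {x x' y y'} : Rel x x' → Rel y y' → Rel (.oplus x y) (.oplus x' y')
  | neg {x x'} : Rel x x' → Rel (.neg x) (.neg x')
  | oplus_assoc (x y z) : Rel (.oplus (.oplus x y) z) (.oplus x (.oplus y z))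
  | oplus_comm (x y) : Rel (.oplus x y) (.oplus y x)
  | oplus_zero (x) : Rel (.oplus x .zero) x
  | neg_neg (x) : Rel (.neg (.neg x)) x
  | oplus_neg_zero (x) : Rel (.oplus x (.neg .zero)) (.neg .zero)
  | oplus_neg_oplus (x y) : Rel (.oplus x (.neg (.oplus x (.neg y))))
      (.oplus y (.neg (.oplus y (.neg x))))

/-- Derivable equality of terms as an equivalence relation. -/
def MVTerm.setoid (X : Type u) : Setoid (MVTerm X) :=
  ⟨MVTerm.Rel, ⟨MVTerm.Rel.refl, MVTerm.Rel.symm, MVTerm.Rel.trans⟩⟩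

/-- The free MV-algebra on `X`: terms modulo derivable equality. -/
def FreeMV (X : Type u) : Type u := Quotient (MVTerm.setoid X)

instance (X : Type u) : MVAlgebra (FreeMV X) where
  zero := Quotient.mk (MVTerm.setoid X) .zero
  oplus := Quotient.map₂ .oplus fun _ _ h _ _ h' => MVTerm.Rel.oplus h h'
  neg := Quotient.map .neg fun _ _ h => MVTerm.Rel.neg h
  oplus_assoc x y z := by
    induction x using Quotient.inductionOn
    induction y using Quotient.inductionOn
    induction z using Quotient.inductionOn
    exact Quotient.sound (MVTerm.Rel.oplus_assoc _ _ _)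
  oplus_comm x y := by
    induction x using Quotient.inductionOn
    induction y using Quotient.inductionOn
    exact Quotient.sound (MVTerm.Rel.oplus_comm _ _)
  oplus_zero x := by
    induction x using Quotient.inductionOn
    exact Quotient.sound (MVTerm.Rel.oplus_zero _)
  neg_neg x := by
    induction x using Quotient.inductionOn
    exact Quotient.sound (MVTerm.Rel.neg_neg _)
  oplus_neg_zero x := by
    induction x using Quotient.inductionOn
    exact Quotient.sound (MVTerm.Rel.oplus_neg_zero _)
  oplus_neg_oplus x y := by
    induction x using Quotient.inductionOn
    induction y using Quotient.inductionOn
    exact Quotient.sound (MVTerm.Rel.oplus_neg_oplus _ _)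

/-- The free generators. -/
def FreeMV.of {X : Type u} (x : X) : FreeMV X := Quotient.mk (MVTerm.setoid X) (.var x)

/-- The MV-algebra presented by generators `X` and relations `S`. -/
def PresentedMV (X : Type u) (S : Set (FreeMV X × FreeMV X)) : Type u := (MVCon.gen S).Quot

instance (X : Type u) (S : Set (FreeMV X × FreeMV X)) : MVAlgebra (PresentedMV X S) :=
  inferInstanceAs (MVAlgebra (MVCon.gen S).Quot)

/-! ## Tensor products and coproducts -/

/-- The defining relations of the MV-tensor product: the universal solution
`A × B → A ⊗ B` is a bimorphism. -/
inductive TensorRel (A : Type u) (B : Type v) [MVAlgebra A] [MVAlgebra B] :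
    FreeMV (A × B) × FreeMV (A × B) → Prop
  | one_one : TensorRel A B (.of (one, one), one)
  | zero_right (a : A) : TensorRel A B (.of (a, zero), zero)
  | zero_left (b : B) : TensorRel A B (.of (zero, b), zero)
  | join_right (a : A) (b₁ b₂ : B) :
      TensorRel A B (.of (a, join b₁ b₂), join (.of (a, b₁)) (.of (a, b₂)))
  | join_left (a₁ a₂ : A) (b : B) :
      TensorRel A B (.of (join a₁ a₂, b), join (.of (a₁, b)) (.of (a₂, b)))
  | meet_right (a : A) (b₁ b₂ : B) :
      TensorRel A B (.of (a, meet b₁ b₂), meet (.of (a, b₁)) (.of (a, b₂)))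
  | meet_left (a₁ a₂ : A) (b : B) :
      TensorRel A B (.of (meet a₁ a₂, b), meet (.of (a₁, b)) (.of (a₂, b)))
  | odot_right (a : A) (b₁ b₂ : B) : odot b₁ b₂ = zero →
      TensorRel A B (odot (.of (a, b₁)) (.of (a, b₂)), zero)
  | odot_left (a₁ a₂ : A) (b : B) : odot a₁ a₂ = zero →
      TensorRel A B (odot (.of (a₁, b)) (.of (a₂, b)), zero)
  | oplus_right (a : A) (b₁ b₂ : B) : odot b₁ b₂ = zero →
      TensorRel A B (.of (a, oplus b₁ b₂), oplus (.of (a, b₁)) (.of (a, b₂)))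
  | oplus_left (a₁ a₂ : A) (b : B) : odot a₁ a₂ = zero →
      TensorRel A B (.of (oplus a₁ a₂, b), oplus (.of (a₁, b)) (.of (a₂, b)))

/-- The MV-algebraic tensor product. -/
abbrev MVTensor (A : Type u) (B : Type v) [MVAlgebra A] [MVAlgebra B] : Type (max u v) :=
  PresentedMV (A × B) {p | TensorRel A B p}

/-- The semisimple tensor product: the MV-tensor product modulo its radical. -/
abbrev SemisimpleTensor (A : Type u) (B : Type v) [MVAlgebra A] [MVAlgebra B] :
    Type (max u v) :=
  SemisimpleQuot (MVTensor A B)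

/-- The defining relations of the coproduct: the two inclusions are homomorphisms. -/
inductive CoproductRel (A : Type u) (B : Type v) [MVAlgebra A] [MVAlgebra B] :
    FreeMV (A ⊕ B) × FreeMV (A ⊕ B) → Prop
  | zero_inl : CoproductRel A B (.of (.inl zero), zero)
  | zero_inr : CoproductRel A B (.of (.inr zero), zero)
  | oplus_inl (a₁ a₂ : A) :
      CoproductRel A B (.of (.inl (oplus a₁ a₂)), oplus (.of (.inl a₁)) (.of (.inl a₂)))
  | oplus_inr (b₁ b₂ : B) :
      CoproductRel A B (.of (.inr (oplus b₁ b₂)), oplus (.of (.inr b₁)) (.of (.inr b₂)))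
  | neg_inl (a : A) : CoproductRel A B (.of (.inl (neg a)), neg (.of (.inl a)))
  | neg_inr (b : B) : CoproductRel A B (.of (.inr (neg b)), neg (.of (.inr b)))

/-- The coproduct in the category of MV-algebras. -/
abbrev MVCoproduct (A : Type u) (B : Type v) [MVAlgebra A] [MVAlgebra B] : Type (max u v) :=
  PresentedMV (A ⊕ B) {p | CoproductRel A B p}

/-- The coproduct in the category of semisimple MV-algebras: the reflection of the coproduct of
MV-algebras, which may fail to be semisimple. -/
abbrev SemisimpleCoproduct (A : Type u) (B : Type v) [MVAlgebra A] [MVAlgebra B] :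
    Type (max u v) :=
  SemisimpleQuot (MVCoproduct A B)

/-! ## Dual spaces and `ℤ`-maps -/

/-- The dual space `W(A) = Hom(A, [0,1])`, as a subset of the Tychonoff cube `[0,1]^A`
(whose topology is the product topology). -/
def dualSpace (A : Type u) [MVAlgebra A] : Set (A → unitInterval) := {f | IsMVHom f}

/-- A continuous piecewise (affine) linear map with integer coefficients on a
finite-dimensional cube. -/
def IsIntegralPL {κ : Type u} [Fintype κ] (f : (κ → unitInterval) → unitInterval) : Prop :=
  Continuous f ∧ ∃ F : Finset ((κ → ℤ) × ℤ), ∀ x : κ → unitInterval,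
    ∃ c ∈ F, (f x : ℝ) = ∑ k, (c.1 k : ℝ) * (x k : ℝ) + (c.2 : ℝ)

/-- A piecewise linear map with integer coefficients on an arbitrary cube `[0,1]^I`: it factors
through the projection onto finitely many coordinates. -/
def IsIntegralPLOnCube {I : Type u} (f : (I → unitInterval) → unitInterval) : Prop :=
  ∃ (I' : Finset I) (f' : (I' → unitInterval) → unitInterval), IsIntegralPL f' ∧
    ∀ p : I → unitInterval, f p = f' fun i => p i

/-- A map between subsets of Tychonoff cubes is a `ℤ`-map if each of its coordinates is the
restriction of a piecewise linear map with integer coefficients on the enveloping cube. -/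
def IsZMap {I : Type u} {J : Type v} {P : Set (I → unitInterval)} {Q : Set (J → unitInterval)}
    (η : P → Q) : Prop :=
  ∀ j : J, ∃ ξ : (I → unitInterval) → unitInterval, IsIntegralPLOnCube ξ ∧
    ∀ p : P, (η p : J → unitInterval) j = ξ p

/-- Two subsets of Tychonoff cubes are `ℤ`-homeomorphic if some homeomorphism between them is a
`ℤ`-map in both directions. -/
def ZHomeomorphic {I : Type u} {J : Type v} (P : Set (I → unitInterval))
    (Q : Set (J → unitInterval)) : Prop :=
  ∃ e : P ≃ₜ Q, IsZMap e ∧ IsZMap e.symm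

/-- The pointwise product map `[0,1]^A × [0,1]^B → [0,1]^(A × B)`, `(f · g)(a, b) = f a * g b`. -/
def cubeMul {A : Type u} {B : Type v} (p : (A → unitInterval) × (B → unitInterval)) :
    A × B → unitInterval :=
  fun c => p.1 c.1 * p.2 c.2

/-- The canonical identification `[0,1]^A × [0,1]^B → [0,1]^(A ⊎ B)`. -/
def cubeSum {A : Type u} {B : Type v} (p : (A → unitInterval) × (B → unitInterval)) :
    A ⊕ B → unitInterval :=
  Sum.elim p.1 p.2

/-! A homomorphism from a presented algebra to `[0,1]` amounts to an assignment of the generators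
that satisfies the relations. One passes between the two by coordinate projections and by term
functions, which are piecewise linear with integer coefficients, so the dual is `ℤ`-homeomorphic to
the solution set (`zHomeomorphic_dualSpace_of_surjective`). Factoring out the radical does not
change this, since kernels of homomorphisms to `[0,1]` are maximal congruences
(`IsMVHom.ker_isMaximal`).

It remains to solve the relations in `[0,1]`. For the coproduct, solutions are pairs of
homomorphisms by definition. For the tensor product, let `v` be a solution and put `f = v(·,1)` and
`g = v(1,·)`, which are homomorphisms. Each `v(a,·)` preserves meets and partial sums and lies below
`g`; a doubling argument (`IsPartialSumHom.eq_mul_of_le`) then forces `v(a,·) = f(a) g`.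

Evaluating `f · g` at `(a,1)` and `(1,b)` recovers `f` and `g`, so the two solution sets are
homeomorphic. They need not be `ℤ`-homeomorphic: `ℤ`-maps keep coordinates in `½ℤ` inside `½ℤ`, but
for the three-element chain the product takes the value `½ · ½ = ¼`. -/

/-! ## Arithmetic of MV-algebras and of the standard MV-algebra -/

namespace MVAlgebra

variable {A : Type u} [MVAlgebra A]

theorem neg_one : neg (one : A) = zero := neg_neg _

theorem oplus_one (x : A) : oplus x one = one := oplus_neg_zero x

theorem one_oplus (x : A) : oplus one x = one := by rw [oplus_comm, oplus_one]

theorem oplus_neg_self (x : A) : oplus x (neg x) = one := by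
  have h := oplus_neg_oplus x one
  rwa [neg_one, oplus_zero, one_oplus] at h

theorem odot_neg_self (x : A) : odot x (neg x) = zero := by
  rw [odot, oplus_neg_self, neg_one]

theorem meet_one (x : A) : meet x one = x := by
  simp only [meet, join, neg_one, oplus_zero, neg_neg]

theorem meet_zero (x : A) : meet x zero = zero := by
  change neg (oplus _ one) = zero
  rw [oplus_one, neg_one]

/-- Together with `odot_neg_meet` this rewrites an arbitrary sum as a partial one, whose summands
have `⊙`-product `0`. Both are derived from the axioms because they are needed in arbitrary
algebras. -/
theorem oplus_neg_meet (x y : A) : oplus x (meet (neg x) y) = oplus x y := by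
  have h₁ := oplus_neg_oplus (neg y) x
  have h₂ := oplus_neg_oplus x (oplus x y)
  rw [neg_neg] at h₁
  have h₃ : oplus (oplus x y) (neg x) = one := by
    rw [oplus_comm x y, oplus_assoc, oplus_neg_self, oplus_one]
  rw [h₃, neg_one, oplus_zero] at h₂
  rw [meet, join, neg_neg, oplus_comm (neg (oplus _ _)), oplus_comm (neg x), h₁, h₂]

theorem odot_neg_meet (x y : A) : odot x (meet (neg x) y) = zero := by
  have h : oplus (neg x) (oplus (neg (oplus (neg x) (neg y))) (neg y)) = one := by
    rw [oplus_comm (neg (oplus _ _)), ← oplus_assoc, oplus_neg_self]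
  rw [odot, meet, join, neg_neg, neg_neg, h, neg_one]

end MVAlgebra

namespace unitInterval

variable (x y : unitInterval)

theorem coe_mvZero : ((MVAlgebra.zero : unitInterval) : ℝ) = 0 := rfl

theorem coe_oplus : ((oplus x y : unitInterval) : ℝ) = min ((x : ℝ) + y) 1 := rfl

theorem coe_neg : ((neg x : unitInterval) : ℝ) = 1 - x := rfl

theorem coe_mvOne : ((MVAlgebra.one : unitInterval) : ℝ) = 1 := sub_zero 1

theorem mvOne_eq : (MVAlgebra.one : unitInterval) = 1 := Subtype.ext coe_mvOne

theorem coe_odot : ((odot x y : unitInterval) : ℝ) = max ((x : ℝ) + y - 1) 0 := by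
  simp only [odot, coe_oplus, coe_neg, min_def, max_def]
  split_ifs <;> linarith

theorem coe_join : ((join x y : unitInterval) : ℝ) = max (x : ℝ) y := by
  have hx := x.2; have hy := y.2
  simp only [Set.mem_Icc] at hx hy
  simp only [join, coe_oplus, coe_neg, min_def, max_def]
  split_ifs <;> linarith

theorem coe_meet : ((meet x y : unitInterval) : ℝ) = min (x : ℝ) y := by
  simp only [meet, coe_join, coe_neg, min_def, max_def]
  split_ifs <;> linarith

theorem odot_eq_zero_iff : odot x y = MVAlgebra.zero ↔ (x : ℝ) + y ≤ 1 := by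
  rw [Subtype.ext_iff, coe_odot, coe_mvZero, max_eq_right_iff, sub_nonpos]

end unitInterval

open unitInterval (coe_mvZero coe_oplus coe_neg coe_mvOne mvOne_eq coe_odot coe_join coe_meet
  odot_eq_zero_iff)

/-! ## Homomorphisms and their kernels -/

namespace IsMVHom

variable {A : Type u} {B : Type v} [MVAlgebra A] [MVAlgebra B] {f : A → B}

theorem map_one (hf : IsMVHom f) : f one = one := by
  rw [MVAlgebra.one, hf.map_neg, hf.map_zero, MVAlgebra.one]

theorem map_odot (hf : IsMVHom f) (x y : A) : f (odot x y) = odot (f x) (f y) := by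
  simp only [odot, hf.map_neg, hf.map_oplus]

theorem map_join (hf : IsMVHom f) (x y : A) : f (join x y) = join (f x) (f y) := by
  simp only [join, hf.map_neg, hf.map_oplus]

theorem map_meet (hf : IsMVHom f) (x y : A) : f (meet x y) = meet (f x) (f y) := by
  simp only [meet, hf.map_neg, hf.map_join]

theorem comp {C : Type*} [MVAlgebra C] {g : B → C} (hg : IsMVHom g) (hf : IsMVHom f) :
    IsMVHom (g ∘ f) where
  map_zero := by simp only [Function.comp, hf.map_zero, hg.map_zero]
  map_oplus x y := by simp only [Function.comp, hf.map_oplus, hg.map_oplus]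
  map_neg x := by simp only [Function.comp, hf.map_neg, hg.map_neg]

/-- The kernel of a homomorphism. -/
def ker (hf : IsMVHom f) : MVCon A where
  r x y := f x = f y
  iseqv := ⟨fun _ => rfl, Eq.symm, Eq.trans⟩
  oplus' h h' := by rw [hf.map_oplus, hf.map_oplus, h, h']
  neg' h := by rw [hf.map_neg, hf.map_neg, h]

/-- A map induced on quotients along a surjective homomorphism is a homomorphism. -/
theorem of_comp_surjective {C : Type*} [MVAlgebra C] {π : A → C} (hπ : IsMVHom π)
    (hs : Function.Surjective π) {g : C → B} (h : IsMVHom (g ∘ π)) : IsMVHom g where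
  map_zero := by rw [← hπ.map_zero]; exact h.map_zero
  map_oplus x y := by
    obtain ⟨x, rfl⟩ := hs x
    obtain ⟨y, rfl⟩ := hs y
    rw [← hπ.map_oplus]; exact h.map_oplus x y
  map_neg x := by
    obtain ⟨x, rfl⟩ := hs x
    rw [← hπ.map_neg]; exact h.map_neg x

end IsMVHom

namespace MVCon

variable {A : Type u} [MVAlgebra A] (θ : MVCon A)

/-- The quotient map. -/
def toQuot (x : A) : θ.Quot := Quotient.mk θ.toSetoid x

theorem isMVHom_toQuot : IsMVHom θ.toQuot := ⟨rfl, fun _ _ => rfl, fun _ => rfl⟩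

theorem toQuot_surjective : Function.Surjective θ.toQuot := Quotient.mk_surjective

theorem toQuot_eq_toQuot {x y : A} : θ.toQuot x = θ.toQuot y ↔ θ.r x y :=
  ⟨fun h => Quotient.exact h, fun h => Quotient.sound h⟩

variable {θ}

theorem r_refl (x : A) : θ.r x x := θ.iseqv.refl x

theorem r_symm {x y : A} (h : θ.r x y) : θ.r y x := θ.iseqv.symm h

theorem r_trans {x y z : A} (h : θ.r x y) (h' : θ.r y z) : θ.r x z := θ.iseqv.trans h h'

/-- Modulo `θ`, every `x = x ∧ 1` becomes `x ∧ 0 = 0`. -/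
theorem not_isProper_of_r_zero_one (h : θ.r zero one) : ¬ θ.IsProper := by
  have key (x : A) : θ.r zero x := by
    have hmk := θ.isMVHom_toQuot
    rw [← toQuot_eq_toQuot, ← MVAlgebra.meet_one x, hmk.map_meet, ← θ.toQuot_eq_toQuot.2 h, ← hmk.map_meet,
      MVAlgebra.meet_zero]
  rintro ⟨x, y, hxy⟩
  exact hxy (r_trans (r_symm (key x)) (key y))

end MVCon

/-! ### Kernels of homomorphisms to `[0,1]` -/

section Kernel

variable {A : Type u} [MVAlgebra A] {f : A → unitInterval}

/-- The Archimedean property of `ℝ`: an `n`-fold sum of `d` stays congruent to `0` and has value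
`min (n * f d) 1`. -/
theorem IsMVHom.exists_eq_one_of_pos (hf : IsMVHom f) {θ : MVCon A} {d : A} (hd : θ.r d zero)
    (h : 0 < (f d : ℝ)) : ∃ c, θ.r c zero ∧ f c = MVAlgebra.one := by
  have key (n : ℕ) : ∃ c, θ.r c MVAlgebra.zero ∧ (f c : ℝ) = min (n * (f d : ℝ)) 1 := by
    induction n with
    | zero => exact ⟨_, MVCon.r_refl _, by simp [hf.map_zero, coe_mvZero]⟩
    | succ n ih =>
      obtain ⟨c, hc, hcn⟩ := ih
      refine ⟨oplus c d, ?_, ?_⟩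
      · simpa only [MVAlgebra.oplus_zero] using θ.oplus' hc hd
      · rw [hf.map_oplus, coe_oplus, hcn, Nat.cast_succ, add_mul, one_mul]
        simp only [min_def]
        split_ifs <;> linarith
  obtain ⟨n, hn⟩ := exists_nat_gt (1 / (f d : ℝ))
  obtain ⟨c, hc, hcn⟩ := key n
  refine ⟨c, hc, Subtype.ext ?_⟩
  rw [div_lt_iff₀ h] at hn
  rw [hcn, coe_mvOne, min_eq_right hn.le]

theorem IsMVHom.ker_isMaximal (hf : IsMVHom f) : hf.ker.IsMaximal := by
  refine ⟨⟨MVAlgebra.zero, MVAlgebra.one, fun h => ?_⟩, fun φ hφ hle => ?_⟩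
  · change f _ = f _ at h
    rw [hf.map_zero, hf.map_one, Subtype.ext_iff, coe_mvZero, coe_mvOne] at h
    exact zero_ne_one h
  have key (x y : A) (hxy : φ.r x y) : (f x : ℝ) ≤ f y := by
    by_contra! hlt
    -- This is the truncated difference of `x` and `y`, of value `f x - f y > 0`. A multiple `c` has
    -- value `1`, so the kernel, hence `φ`, identifies `c` with `1`, while `φ` also identifies it
    -- with `0`.
    have hd : φ.r (neg (oplus (neg x) y)) MVAlgebra.zero := by
      have h := φ.neg' (φ.oplus' (φ.neg' hxy) (MVCon.r_refl y))
      rwa [MVAlgebra.oplus_comm (neg y), MVAlgebra.oplus_neg_self, MVAlgebra.neg_one] at h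
    obtain ⟨c, hc, hc1⟩ := hf.exists_eq_one_of_pos hd (by
      rw [hf.map_neg, hf.map_oplus, hf.map_neg, coe_neg, coe_oplus, coe_neg, sub_pos]
      exact (min_le_left _ _).trans_lt (by linarith))
    refine MVCon.not_isProper_of_r_zero_one (MVCon.r_trans (MVCon.r_symm hc) (hle _ _ ?_)) hφ
    exact hc1.trans hf.map_one.symm
  exact fun x y h => Subtype.ext (le_antisymm (key x y h) (key y x (MVCon.r_symm h)))

theorem IsMVHom.isSimpleMV (hf : IsMVHom f) (hinj : Function.Injective f) : IsSimpleMV A := by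
  obtain ⟨⟨x, y, hxy⟩, h⟩ := hf.ker_isMaximal
  refine ⟨⟨x, y, fun e => hxy (congrArg f e)⟩, fun φ hφ _ x y hr => hinj (h φ hφ ?_ x y hr)⟩
  intro x y e
  exact hinj e ▸ MVCon.r_refl x

theorem IsSimpleMV.isSemisimpleMV (h : IsSimpleMV A) : IsSemisimpleMV A :=
  ⟨PUnit, fun _ => A, fun _ => inferInstance, fun _ => h, fun a _ => a,
    ⟨rfl, fun _ _ => rfl, fun _ => rfl⟩, fun _ _ h => congrFun h PUnit.unit, fun _ a => ⟨a, rfl⟩⟩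

end Kernel

/-! ## Evaluation of terms -/

section Eval

variable {X : Type u} {M : Type v} [MVAlgebra M]

/-- The value of a term under an assignment of the variables. -/
def MVTerm.eval (v : X → M) : MVTerm X → M
  | .var x => v x
  | .zero => MVAlgebra.zero
  | .oplus s t => MVAlgebra.oplus (s.eval v) (t.eval v)
  | .neg t => MVAlgebra.neg (t.eval v)

theorem MVTerm.Rel.eval_eq (v : X → M) {s t : MVTerm X} (h : MVTerm.Rel s t) :
    s.eval v = t.eval v := by
  induction h with
  | refl => rfl
  | symm _ ih => exact ih.symm
  | trans _ _ ih ih' => exact ih.trans ih'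
  | oplus _ _ ih ih' => simp only [MVTerm.eval, ih, ih']
  | neg _ ih => simp only [MVTerm.eval, ih]
  | oplus_assoc => exact MVAlgebra.oplus_assoc _ _ _
  | oplus_comm => exact MVAlgebra.oplus_comm _ _
  | oplus_zero => exact MVAlgebra.oplus_zero _
  | neg_neg => exact MVAlgebra.neg_neg _
  | oplus_neg_zero => exact MVAlgebra.oplus_neg_zero _
  | oplus_neg_oplus => exact MVAlgebra.oplus_neg_oplus _ _

/-- The homomorphism from the free MV-algebra extending a map on the generators. -/
def FreeMV.lift (v : X → M) : FreeMV X → M :=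
  Quotient.lift (MVTerm.eval v) fun _ _ h => MVTerm.Rel.eval_eq v h

theorem FreeMV.isMVHom_lift (v : X → M) : IsMVHom (FreeMV.lift v) where
  map_zero := rfl
  map_oplus x y := by
    induction x using Quotient.inductionOn
    induction y using Quotient.inductionOn
    rfl
  map_neg x := by
    induction x using Quotient.inductionOn
    rfl

theorem IsMVHom.eq_freeMV_lift {f : FreeMV X → M} (hf : IsMVHom f) (t : FreeMV X) :
    f t = FreeMV.lift (fun x => f (.of x)) t := by
  induction t using Quotient.inductionOn with
  | _ t =>
    induction t with
    | var => rfl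
    | zero => exact hf.map_zero
    | oplus s t hs ht => exact (hf.map_oplus _ _).trans (congrArg₂ _ hs ht)
    | neg t ht => exact (hf.map_neg _).trans (congrArg _ ht)

end Eval

/-! ## Term functions are piecewise linear -/

theorem MVTerm.continuous_eval {X : Type u} (t : MVTerm X) :
    Continuous fun v : X → unitInterval => t.eval v := by
  induction t with
  | var x => exact continuous_apply x
  | zero => exact continuous_const
  | oplus s t hs ht =>
    exact (((continuous_subtype_val.comp hs).add (continuous_subtype_val.comp ht)).min
      continuous_const).subtype_mk _
  | neg t ht => exact (continuous_const.sub (continuous_subtype_val.comp ht)).subtype_mk _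

theorem MVTerm.isIntegralPL_eval {κ : Type u} [Fintype κ] (t : MVTerm κ) :
    IsIntegralPL fun v : κ → unitInterval => t.eval v := by
  classical
  refine ⟨t.continuous_eval, ?_⟩
  induction t with
  | var k =>
    refine ⟨{(Pi.single k 1, 0)}, fun v => ⟨_, Finset.mem_singleton_self _, ?_⟩⟩
    simp [MVTerm.eval, Pi.single_apply]
  | zero =>
    refine ⟨{(0, 0)}, fun v => ⟨_, Finset.mem_singleton_self _, ?_⟩⟩
    simp [MVTerm.eval, coe_mvZero]
  | oplus s t hs ht =>
    obtain ⟨F, hF⟩ := hs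
    obtain ⟨G, hG⟩ := ht
    -- Each value of `min (s + t) 1` is given by a sum of a piece of `s` and a piece of `t`, or by
    -- the constant `1`.
    refine ⟨insert (0, 1) ((F ×ˢ G).image fun c => c.1 + c.2), fun v => ?_⟩
    obtain ⟨c, hc, hcv⟩ := hF v
    obtain ⟨d, hd, hdv⟩ := hG v
    rcases min_choice (((s.eval v : unitInterval) : ℝ) + (t.eval v : unitInterval)) 1 with h | h
    · refine ⟨c + d, Finset.mem_insert_of_mem (Finset.mem_image.2
        ⟨(c, d), Finset.mem_product.2 ⟨hc, hd⟩, rfl⟩), ?_⟩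
      dsimp only [MVTerm.eval] at hcv hdv ⊢
      rw [coe_oplus, h, hcv, hdv]
      simp only [Prod.fst_add, Prod.snd_add, Pi.add_apply, Int.cast_add, add_mul,
        Finset.sum_add_distrib]
      ring
    · refine ⟨(0, 1), Finset.mem_insert_self _ _, ?_⟩
      dsimp only [MVTerm.eval]
      rw [coe_oplus, h]
      simp
  | neg t ht =>
    obtain ⟨F, hF⟩ := ht
    refine ⟨F.image fun c => (-c.1, 1 - c.2), fun v => ?_⟩
    obtain ⟨c, hc, hcv⟩ := hF v
    refine ⟨_, Finset.mem_image_of_mem _ hc, ?_⟩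
    dsimp only [MVTerm.eval] at hcv ⊢
    rw [coe_neg, hcv]
    simp only [Pi.neg_apply, Int.cast_neg, neg_mul, Finset.sum_neg_distrib, Int.cast_sub,
      Int.cast_one]
    ring

/-- A term has finitely many variables. Allowing every `J ⊇ I` lets both summands of a sum be
rewritten over the union of their variable sets. -/
theorem MVTerm.exists_finset_eval_eq {X : Type u} (t : MVTerm X) :
    ∃ I : Finset X, ∀ J : Finset X, I ⊆ J → ∃ t' : MVTerm J,
      ∀ v : X → unitInterval, t.eval v = t'.eval fun j : J => v j := by
  classical
  induction t with
  | var x =>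
    exact ⟨{x}, fun J hJ => ⟨.var ⟨x, hJ (Finset.mem_singleton_self x)⟩, fun v => rfl⟩⟩
  | zero => exact ⟨∅, fun J _ => ⟨.zero, fun v => rfl⟩⟩
  | oplus s t hs ht =>
    obtain ⟨I, hI⟩ := hs
    obtain ⟨I', hI'⟩ := ht
    refine ⟨I ∪ I', fun J hJ => ?_⟩
    obtain ⟨s', hs'⟩ := hI J (Finset.union_subset_left hJ)
    obtain ⟨t', ht'⟩ := hI' J (Finset.union_subset_right hJ)
    exact ⟨.oplus s' t', fun v => congrArg₂ _ (hs' v) (ht' v)⟩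
  | neg t ht =>
    obtain ⟨I, hI⟩ := ht
    refine ⟨I, fun J hJ => ?_⟩
    obtain ⟨t', ht'⟩ := hI J hJ
    exact ⟨.neg t', fun v => congrArg _ (ht' v)⟩

theorem MVTerm.isIntegralPLOnCube_eval {X : Type u} (t : MVTerm X) :
    IsIntegralPLOnCube fun v : X → unitInterval => t.eval v := by
  obtain ⟨I, hI⟩ := t.exists_finset_eval_eq
  obtain ⟨t', ht'⟩ := hI I subset_rfl
  exact ⟨I, _, t'.isIntegralPL_eval, ht'⟩

theorem FreeMV.continuous_lift {X : Type u} (t : FreeMV X) :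
    Continuous fun v : X → unitInterval => FreeMV.lift v t := by
  induction t using Quotient.inductionOn with
  | _ t => exact t.continuous_eval

theorem FreeMV.isIntegralPLOnCube_lift {X : Type u} (t : FreeMV X) :
    IsIntegralPLOnCube fun v : X → unitInterval => FreeMV.lift v t := by
  induction t using Quotient.inductionOn with
  | _ t => exact t.isIntegralPLOnCube_eval

/-! ## Duals of quotients of free algebras -/

/-- The dual of a quotient `M` of the free algebra on `X` is `ℤ`-homeomorphic to the set of
assignments `X → [0,1]` that factor through `M`. -/
theorem zHomeomorphic_dualSpace_of_surjective {X : Type u} {M : Type v} [MVAlgebra M]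
    {π : FreeMV X → M} (hπ : IsMVHom π) (hs : Function.Surjective π) {V : Set (X → unitInterval)}
    (h₁ : ∀ h ∈ dualSpace M, (fun x => h (π (.of x))) ∈ V)
    (h₂ : ∀ v ∈ V, ∀ s t, π s = π t → FreeMV.lift v s = FreeMV.lift v t) :
    ZHomeomorphic (dualSpace M) V := by
  have hsec := Function.surjInv_eq hs
  have hinv (v : V) (t : FreeMV X) :
      FreeMV.lift v.1 (Function.surjInv hs (π t)) = FreeMV.lift v.1 t := h₂ v v.2 _ _ (hsec _)
  have hlift (h : dualSpace M) (t : FreeMV X) :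
      h.1 (π t) = FreeMV.lift (fun x => h.1 (π (.of x))) t :=
    (IsMVHom.comp (f := π) (g := h.1) h.2 hπ).eq_freeMV_lift t
  let e : dualSpace M ≃ₜ V :=
    { toFun := fun h => ⟨fun x => h.1 (π (.of x)), h₁ h.1 h.2⟩
      -- By `h₂` the value does not depend on the chosen preimage of `m`.
      invFun := fun v => ⟨fun m => FreeMV.lift v.1 (Function.surjInv hs m),
        IsMVHom.of_comp_surjective hπ hs (by
          have : (fun m => FreeMV.lift v.1 (Function.surjInv hs m)) ∘ π = FreeMV.lift v.1 :=
            funext (hinv v)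
          rw [this]
          exact FreeMV.isMVHom_lift _)⟩
      left_inv := fun h => Subtype.ext <| funext fun m => by
        change FreeMV.lift (fun x => h.1 (π (.of x))) (Function.surjInv hs m) = h.1 m
        rw [← hlift, hsec]
      right_inv := fun v => Subtype.ext <| funext fun x => hinv v (.of x)
      continuous_toFun := by
        refine Continuous.subtype_mk (continuous_pi fun x => ?_) _
        exact (continuous_apply (π (.of x))).comp continuous_subtype_val
      continuous_invFun := by
        refine Continuous.subtype_mk (continuous_pi fun m => ?_) _
        exact (FreeMV.continuous_lift (Function.surjInv hs m)).comp continuous_subtype_val }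
  -- Coordinates of `e` are projections of the cube; those of its inverse are term functions.
  exact ⟨e, fun x => ⟨fun h => h (π (.of x)), MVTerm.isIntegralPLOnCube_eval (.var (π (.of x))),
      fun h => rfl⟩,
    fun m => ⟨fun v => FreeMV.lift v (Function.surjInv hs m), FreeMV.isIntegralPLOnCube_lift _,
      fun v => rfl⟩⟩

/-- The assignments in `[0,1]` that satisfy the relations `S`. -/
def solutionSet {X : Type u} (S : Set (FreeMV X × FreeMV X)) : Set (X → unitInterval) :=
  {v | ∀ p ∈ S, FreeMV.lift v p.1 = FreeMV.lift v p.2}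

section Presented

variable {X : Type u} {S : Set (FreeMV X × FreeMV X)}

theorem MVCon.gen_r_of_mem {p : FreeMV X × FreeMV X} (hp : p ∈ S) :
    (MVCon.gen S).r p.1 p.2 := fun _ h => h p hp

/-- The kernel of the evaluation at a solution is one of the congruences intersected in `MVCon.gen
S`. -/
theorem lift_eq_of_gen_r {v : X → unitInterval} (hv : v ∈ solutionSet S) {s t : FreeMV X}
    (h : (MVCon.gen S).r s t) : FreeMV.lift v s = FreeMV.lift v t :=
  h (FreeMV.isMVHom_lift v).ker hv

theorem mem_solutionSet_of_isMVHom {f : FreeMV X → unitInterval} (hf : IsMVHom f)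
    (h : ∀ p ∈ S, f p.1 = f p.2) : (fun x => f (.of x)) ∈ solutionSet S := fun p hp => by
  rw [← hf.eq_freeMV_lift, ← hf.eq_freeMV_lift, h p hp]

theorem zHomeomorphic_dualSpace_presentedMV :
    ZHomeomorphic (dualSpace (PresentedMV X S)) (solutionSet S) := by
  refine zHomeomorphic_dualSpace_of_surjective (π := (MVCon.gen S).toQuot) (MVCon.gen S).isMVHom_toQuot
    (MVCon.gen S).toQuot_surjective (fun h hh => ?_) fun v hv s t hst => ?_
  · exact mem_solutionSet_of_isMVHom (IsMVHom.comp (g := h) hh (MVCon.gen S).isMVHom_toQuot)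
      fun p hp => congrArg h ((MVCon.gen S).toQuot_eq_toQuot.2 (MVCon.gen_r_of_mem hp))
  · exact lift_eq_of_gen_r hv ((MVCon.gen S).toQuot_eq_toQuot.1 hst)

theorem zHomeomorphic_dualSpace_semisimpleQuot_presentedMV :
    ZHomeomorphic (dualSpace (SemisimpleQuot (PresentedMV X S))) (solutionSet S) := by
  let ρ := MVCon.radical (PresentedMV X S)
  have hπ : IsMVHom (ρ.toQuot ∘ (MVCon.gen S).toQuot) := ρ.isMVHom_toQuot.comp (MVCon.gen S).isMVHom_toQuot
  refine zHomeomorphic_dualSpace_of_surjective (M := SemisimpleQuot (PresentedMV X S))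
    (π := ρ.toQuot ∘ (MVCon.gen S).toQuot) hπ
    (ρ.toQuot_surjective.comp (MVCon.gen S).toQuot_surjective) (fun h hh => ?_) fun v hv s t hst => ?_
  · exact mem_solutionSet_of_isMVHom (IsMVHom.comp (g := h) hh hπ)
      fun p hp => congrArg (h ∘ ρ.toQuot) ((MVCon.gen S).toQuot_eq_toQuot.2 (MVCon.gen_r_of_mem hp))
  · let g : PresentedMV X S → unitInterval :=
      Quotient.lift (FreeMV.lift v) fun _ _ h => lift_eq_of_gen_r hv h
    have hg : IsMVHom g := IsMVHom.of_comp_surjective (π := (MVCon.gen S).toQuot)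
      (MVCon.gen S).isMVHom_toQuot (MVCon.gen S).toQuot_surjective (FreeMV.isMVHom_lift v)
    -- The kernel of `g` is maximal, so it contains the radical.
    exact ρ.toQuot_eq_toQuot.1 hst hg.ker hg.ker_isMaximal

end Presented

/-! ## Coproducts -/

theorem solutionSet_coproductRel {A : Type u} {B : Type v} [MVAlgebra A] [MVAlgebra B] :
    solutionSet {p | CoproductRel A B p} = cubeSum '' (dualSpace A ×ˢ dualSpace B) := by
  ext v
  constructor
  · intro hv
    refine ⟨(fun a => v (.inl a), fun b => v (.inr b)), ⟨?_, ?_⟩, ?_⟩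
    · exact ⟨hv _ .zero_inl, fun x y => hv _ (.oplus_inl x y), fun x => hv _ (.neg_inl x)⟩
    · exact ⟨hv _ .zero_inr, fun x y => hv _ (.oplus_inr x y), fun x => hv _ (.neg_inr x)⟩
    · exact Sum.elim_comp_inl_inr v
  · rintro ⟨⟨f, g⟩, ⟨hf, hg⟩, rfl⟩ p hp
    cases hp with
    | zero_inl => exact hf.map_zero
    | zero_inr => exact hg.map_zero
    | oplus_inl x y => exact hf.map_oplus x y
    | oplus_inr x y => exact hg.map_oplus x y
    | neg_inl x => exact hf.map_neg x
    | neg_inr x => exact hg.map_neg x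

/-! ## Bimorphisms to the standard MV-algebra -/

/-- A map to `[0,1]` that preserves `0`, meets and partial sums. -/
structure IsPartialSumHom {B : Type v} [MVAlgebra B] (φ : B → unitInterval) : Prop where
  map_zero : φ zero = zero
  map_meet : ∀ x y, φ (meet x y) = meet (φ x) (φ y)
  map_odot : ∀ x y, odot x y = zero → odot (φ x) (φ y) = zero
  map_oplus : ∀ x y, odot x y = zero → φ (oplus x y) = oplus (φ x) (φ y)

namespace IsPartialSumHom

variable {B : Type v} [MVAlgebra B] {φ : B → unitInterval}

theorem coe_map_oplus_of_odot (h : IsPartialSumHom φ) {x y : B} (hxy : odot x y = MVAlgebra.zero) :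
    (φ (oplus x y) : ℝ) = φ x + φ y := by
  rw [h.map_oplus x y hxy, coe_oplus,
    min_eq_left ((odot_eq_zero_iff _ _).1 (h.map_odot x y hxy))]

theorem coe_map_neg (h : IsPartialSumHom φ) (x : B) :
    (φ (neg x) : ℝ) = φ MVAlgebra.one - φ x := by
  rw [← MVAlgebra.oplus_neg_self x, h.coe_map_oplus_of_odot (MVAlgebra.odot_neg_self x)]
  ring

/-- Since `x ⊕ y` is the partial sum of `x` and `¬x ∧ y`, its value is `φ x + min (φ 1 - φ x) (φ
y)`. Thus `φ` is additive up to truncation at `φ 1`, and is a homomorphism once `φ 1 = 1`. -/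
theorem coe_map_oplus (h : IsPartialSumHom φ) (x y : B) :
    (φ (oplus x y) : ℝ) = min ((φ x : ℝ) + φ y) (φ MVAlgebra.one) := by
  rw [← MVAlgebra.oplus_neg_meet, h.coe_map_oplus_of_odot (MVAlgebra.odot_neg_meet x y),
    h.map_meet, coe_meet, h.coe_map_neg, ← min_add_add_left, min_comm]
  congr 1
  ring

theorem isMVHom (h : IsPartialSumHom φ) (h1 : φ MVAlgebra.one = MVAlgebra.one) : IsMVHom φ where
  map_zero := h.map_zero
  map_oplus x y := Subtype.ext (by rw [h.coe_map_oplus, h1, coe_oplus, coe_mvOne])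
  map_neg x := Subtype.ext (by rw [h.coe_map_neg, h1, coe_neg, coe_mvOne])

/-- A partial-sum homomorphism that is dominated by a homomorphism is a multiple of it. -/
theorem eq_mul_of_le (h : IsPartialSumHom φ) {g : B → unitInterval} (hg : IsMVHom g)
    (hle : ∀ x, (φ x : ℝ) ≤ g x) (x : B) : (φ x : ℝ) = φ MVAlgebra.one * g x := by
  set t := ((φ MVAlgebra.one : unitInterval) : ℝ)
  have ht0 : 0 ≤ t := (φ MVAlgebra.one).2.1
  have ht1 : t ≤ 1 := (φ MVAlgebra.one).2.2
  -- The defect `φ x - t * g x` doubles from `x` to `x ⊕ x`: here `g (x ⊙ x) = 0`, so domination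
  -- gives `φ (x ⊙ x) = 0`. This means `2 * φ x ≤ t`, and neither sum is truncated.
  have half (x : B) (hx : (g x : ℝ) ≤ 1 / 2) :
      (φ (oplus x x) : ℝ) - t * g (oplus x x) = 2 * (φ x - t * g x) := by
    have h0 : (g (odot x x) : ℝ) = 0 := by
      rw [hg.map_odot, coe_odot, max_eq_right (by linarith)]
    have h1 : (φ (odot x x) : ℝ) ≤ 0 := h0 ▸ hle _
    rw [odot, h.coe_map_neg, h.coe_map_oplus, h.coe_map_neg] at h1
    have h2 : (φ x : ℝ) + φ x ≤ t := by
      rcases min_choice (t - φ x + (t - φ x)) t with h' | h' <;> change t - min _ t ≤ 0 at h1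
      · rw [h'] at h1; linarith
      · have := min_le_left (t - φ x + (t - φ x)) t
        rw [h'] at this; linarith
    rw [h.coe_map_oplus, min_eq_left h2, hg.map_oplus, coe_oplus, min_eq_left (by linarith)]
    ring
  have double (x : B) : ∃ y, |(φ y : ℝ) - t * g y| = 2 * |(φ x : ℝ) - t * g x| := by
    rcases le_total (g x : ℝ) (1 / 2) with hx | hx
    · exact ⟨oplus x x, by rw [half x hx, abs_mul, abs_two]⟩
    -- Negation only changes the sign of the defect, and `g (¬x) ≤ 1/2`.
    · refine ⟨oplus (neg x) (neg x), ?_⟩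
      rw [half _ (by rw [hg.map_neg, coe_neg]; linarith), abs_mul, abs_two, h.coe_map_neg,
        hg.map_neg, coe_neg, ← abs_neg]
      congr 2
      ring
  have iter (n : ℕ) : ∃ y, |(φ y : ℝ) - t * g y| = 2 ^ n * |(φ x : ℝ) - t * g x| := by
    induction n with
    | zero => exact ⟨x, by rw [pow_zero, one_mul]⟩
    | succ n ih =>
      obtain ⟨y, hy⟩ := ih
      obtain ⟨z, hz⟩ := double y
      exact ⟨z, by rw [hz, hy]; ring⟩
  -- Both terms lie in `[0,1]`, so a nonzero defect cannot be doubled indefinitely.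
  have bound (y : B) : |(φ y : ℝ) - t * g y| ≤ 1 := by
    have h1 := (φ y).2.1
    have h2 := (φ y).2.2
    have h3 : 0 ≤ t * g y := mul_nonneg ht0 (g y).2.1
    have h4 : t * g y ≤ 1 := mul_le_one₀ ht1 (g y).2.1 (g y).2.2
    rw [abs_le]
    constructor <;> linarith
  by_contra hne
  have hpos : 0 < |(φ x : ℝ) - t * g x| := abs_pos.2 (sub_ne_zero.2 hne)
  obtain ⟨n, hn⟩ := pow_unbounded_of_one_lt (1 / |(φ x : ℝ) - t * g x|) one_lt_two
  obtain ⟨y, hy⟩ := iter n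
  rw [div_lt_iff₀ hpos, ← hy] at hn
  exact (bound y).not_gt hn

end IsPartialSumHom

/-! ### Solutions of the tensor relations -/

section Tensor

variable {A : Type u} {B : Type v} [MVAlgebra A] [MVAlgebra B]

theorem isPartialSumHom_right {v : A × B → unitInterval}
    (hv : v ∈ solutionSet {p | TensorRel A B p}) (a : A) : IsPartialSumHom fun b => v (a, b) where
  map_zero := hv _ (.zero_right a)
  map_meet x y := hv _ (.meet_right a x y)
  map_odot x y h := hv _ (.odot_right a x y h)
  map_oplus x y h := hv _ (.oplus_right a x y h)

theorem isPartialSumHom_left {v : A × B → unitInterval}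
    (hv : v ∈ solutionSet {p | TensorRel A B p}) (b : B) : IsPartialSumHom fun a => v (a, b) where
  map_zero := hv _ (.zero_left b)
  map_meet x y := hv _ (.meet_left x y b)
  map_odot x y h := hv _ (.odot_left x y b h)
  map_oplus x y h := hv _ (.oplus_left x y b h)

/-- Multiplication by `c ∈ [0,1]` is monotone and additive, and on a partial sum truncation takes
effect neither before nor after scaling. -/
theorem IsMVHom.isPartialSumHom_smul {g : B → unitInterval} (hg : IsMVHom g) (c : unitInterval) :
    IsPartialSumHom fun b => c * g b := by
  have hodot {x y : B} (h : odot x y = MVAlgebra.zero) : (g x : ℝ) + g y ≤ 1 := by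
    rw [← odot_eq_zero_iff, ← hg.map_odot, h, hg.map_zero]
  have hle {x y : B} (h : odot x y = MVAlgebra.zero) : (c * g x : ℝ) + c * g y ≤ 1 := by
    rw [← mul_add]
    exact mul_le_one₀ c.2.2 (add_nonneg (g x).2.1 (g y).2.1) (hodot h)
  refine ⟨?_, fun x y => ?_, fun x y h => ?_, fun x y h => ?_⟩
  · exact Subtype.ext (by rw [hg.map_zero]; exact mul_zero _)
  · refine Subtype.ext ?_
    rw [hg.map_meet, coe_meet, Set.Icc.coe_mul, coe_meet, mul_min_of_nonneg _ _ c.2.1]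
    rfl
  · exact (odot_eq_zero_iff _ _).2 (hle h)
  · refine Subtype.ext ?_
    rw [hg.map_oplus, coe_oplus, Set.Icc.coe_mul, coe_oplus, min_eq_left (hodot h), mul_add]
    exact (min_eq_left (hle h)).symm

theorem IsMVHom.mul_map_join {g : B → unitInterval} (hg : IsMVHom g) (c : unitInterval) (x y : B) :
    c * g (join x y) = join (c * g x) (c * g y) := by
  refine Subtype.ext ?_
  rw [hg.map_join, coe_join, Set.Icc.coe_mul, coe_join, mul_max_of_nonneg _ _ c.2.1]
  rfl

theorem solutionSet_tensorRel :
    solutionSet {p | TensorRel A B p} = cubeMul '' (dualSpace A ×ˢ dualSpace B) := by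
  ext v
  constructor
  · intro hv
    have h1 : v (one, one) = one := hv _ .one_one
    have hf : IsMVHom fun a => v (a, one) := (isPartialSumHom_left hv one).isMVHom h1
    have hg : IsMVHom fun b => v (one, b) := (isPartialSumHom_right hv one).isMVHom h1
    refine ⟨(fun a => v (a, one), fun b => v (one, b)), ⟨hf, hg⟩, ?_⟩
    ext ⟨a, b⟩
    refine ((isPartialSumHom_right hv a).eq_mul_of_le hg (fun b => ?_) b).symm
    -- From `a ∧ 1 = a` one gets `v (a, b) = v (a, b) ∧ v (1, b)`, which is the domination required
    -- by `eq_mul_of_le`.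
    have h := hv _ (.meet_left a one b)
    rw [MVAlgebra.meet_one] at h
    replace h : v (a, b) = meet (v (a, b)) (v (one, b)) := h
    rw [h, coe_meet]
    exact min_le_right _ _
  · rintro ⟨⟨f, g⟩, ⟨hf, hg⟩, rfl⟩ p hp
    have hr (a : A) := hg.isPartialSumHom_smul (f a)
    have hl (b : B) : IsPartialSumHom fun a => f a * g b := by
      simpa only [mul_comm] using hf.isPartialSumHom_smul (g b)
    cases hp with
    | one_one =>
      change f one * g one = one
      rw [IsMVHom.map_one (f := f) hf, IsMVHom.map_one (f := g) hg, mvOne_eq, mul_one]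
    | zero_right a => exact (hr a).map_zero
    | zero_left b => exact (hl b).map_zero
    | join_right a x y => exact hg.mul_map_join (f a) x y
    | join_left x y b =>
      have h := hf.mul_map_join (g b) x y
      simp only [mul_comm (g b)] at h
      exact h
    | meet_right a x y => exact (hr a).map_meet x y
    | meet_left x y b => exact (hl b).map_meet x y
    | odot_right a x y h => exact (hr a).map_odot x y h
    | odot_left x y b h => exact (hl b).map_odot x y h
    | oplus_right a x y h => exact (hr a).map_oplus x y h
    | oplus_left x y b h => exact (hl b).map_oplus x y h

/-- The products `f · g` determine the homomorphisms `f` and `g`, continuously. -/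
def cubeMulHomeoCubeSum : cubeMul '' (dualSpace A ×ˢ dualSpace B) ≃ₜ
    cubeSum '' (dualSpace A ×ˢ dualSpace B) where
  toFun p := ⟨Sum.elim (fun a => p.1 (a, one)) fun b => p.1 (one, b), by
    obtain ⟨_, ⟨f, g⟩, ⟨hf, hg⟩, rfl⟩ := p
    refine ⟨(f, g), ⟨hf, hg⟩, ?_⟩
    ext (a | b)
    · simp [cubeMul, cubeSum, IsMVHom.map_one (f := g) hg, mvOne_eq]
    · simp [cubeMul, cubeSum, IsMVHom.map_one (f := f) hf, mvOne_eq]⟩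
  -- Multiplication on `[0,1]²` is continuous but not piecewise linear; this is where integrality
  -- can be lost.
  invFun q := ⟨fun c => q.1 (.inl c.1) * q.1 (.inr c.2), by
    obtain ⟨_, ⟨f, g⟩, ⟨hf, hg⟩, rfl⟩ := q
    exact ⟨(f, g), ⟨hf, hg⟩, rfl⟩⟩
  left_inv := by
    rintro ⟨_, ⟨f, g⟩, ⟨hf, hg⟩, rfl⟩
    ext ⟨a, b⟩
    simp [cubeMul, IsMVHom.map_one (f := g) hg, IsMVHom.map_one (f := f) hf, mvOne_eq]
  right_inv := by
    rintro ⟨_, ⟨f, g⟩, ⟨hf, hg⟩, rfl⟩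
    ext (a | b)
    · simp [cubeSum, IsMVHom.map_one (f := g) hg, mvOne_eq]
    · simp [cubeSum, IsMVHom.map_one (f := f) hf, mvOne_eq]
  continuous_toFun := by
    refine Continuous.subtype_mk (continuous_pi ?_) _
    rintro (a | b) <;> exact (continuous_apply _).comp continuous_subtype_val
  continuous_invFun := by
    refine Continuous.subtype_mk (continuous_pi fun c => ?_) _
    exact ((continuous_apply _).comp continuous_subtype_val).mul
      ((continuous_apply _).comp continuous_subtype_val)

end Tensor

/-! ## Coordinates of `ℤ`-maps -/

/-- At `p` the map agrees with an affine map with integer coefficients. Multiplying by `d` keeps the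
linear part integral by `hp` and the constant term integral by `hd`. -/
theorem IsIntegralPLOnCube.exists_int_eq {I : Type u} {ξ : (I → unitInterval) → unitInterval}
    (h : IsIntegralPLOnCube ξ) {d : ℝ} {p : I → unitInterval} (hp : ∀ i, ∃ n : ℤ, d * p i = n)
    (hd : ∃ n : ℤ, d = n) : ∃ n : ℤ, d * ξ p = n := by
  obtain ⟨J, f, ⟨-, F, hF⟩, hf⟩ := h
  obtain ⟨c, -, hc⟩ := hF fun i => p i
  choose n hn using hp
  obtain ⟨m, hm⟩ := hd
  refine ⟨∑ i : J, c.1 i * n i + c.2 * m, ?_⟩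
  rw [hf, hc, mul_add, Finset.mul_sum]
  push_cast
  rw [← hm, mul_comm d (c.2 : ℝ)]
  congr 1
  refine Finset.sum_congr rfl fun i _ => ?_
  rw [← hn]
  ring

/-! ## The three-element chain -/

/-- The three-element MV-chain, with `k` standing for `k / 2`. -/
instance Fin.instMVAlgebraThree : MVAlgebra (Fin 3) where
  zero := 0
  oplus x y := ⟨min (x + y : ℕ) 2, by omega⟩
  neg x := ⟨2 - x, by omega⟩
  oplus_assoc := by decide
  oplus_comm := by decide
  oplus_zero := by decide
  neg_neg := by decide
  oplus_neg_zero := by decide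
  oplus_neg_oplus := by decide

/-- The embedding of the three-element chain into `[0,1]`. -/
noncomputable def finThreeEmbedding (x : Fin 3) : unitInterval :=
  ⟨(x : ℕ) / 2, by positivity, by
    have : ((x : ℕ) : ℝ) ≤ 2 := by exact_mod_cast Nat.le_of_lt_succ x.2
    linarith⟩

theorem isMVHom_finThreeEmbedding : IsMVHom finThreeEmbedding where
  map_zero := Subtype.ext (by simp [finThreeEmbedding, MVAlgebra.zero])
  map_oplus x y := Subtype.ext (by
    rw [coe_oplus]
    change ((min (x + y : ℕ) 2 : ℕ) : ℝ) / 2 = min ((x : ℕ) / 2 + (y : ℕ) / 2 : ℝ) 1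
    push_cast
    simp only [min_def]
    split_ifs <;> linarith)
  map_neg x := Subtype.ext (by
    rw [coe_neg]
    change ((2 - x : ℕ) : ℝ) / 2 = 1 - (x : ℕ) / 2
    rw [Nat.cast_sub (Nat.le_of_lt_succ x.2)]
    push_cast
    ring)

theorem finThreeEmbedding_injective : Function.Injective finThreeEmbedding := fun x y h => by
  have h' : ((x : ℕ) : ℝ) / 2 = (y : ℕ) / 2 := congrArg Subtype.val h
  exact Fin.ext (by exact_mod_cast (div_left_inj' two_ne_zero).1 h')

theorem isSemisimpleMV_fin_three : IsSemisimpleMV (Fin 3) :=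
  (isMVHom_finThreeEmbedding.isSimpleMV finThreeEmbedding_injective).isSemisimpleMV

/-- The middle element is its own negation, so its value solves `r = 1 - r`. -/
theorem IsMVHom.coe_fin_three {f : Fin 3 → unitInterval} (hf : IsMVHom f) (x : Fin 3) :
    (f x : ℝ) = (x : ℕ) / 2 := by
  have h0 : f 0 = MVAlgebra.zero := hf.map_zero
  have h1 : f 1 = neg (f 1) := hf.map_neg 1
  have h2 : f 2 = MVAlgebra.one := hf.map_one
  rw [Subtype.ext_iff, coe_neg] at h1
  fin_cases x
  · simp [h0, coe_mvZero]
  · simp only [Fin.mk_one]; norm_num; linarith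
  · simp [h2, coe_mvOne]

/-- The dual of `L₃ ⊗ L₃` has a coordinate with value `1/4`, whereas all coordinates of points
in the dual of `L₃ ⨿ L₃` are multiples of `1/2`. -/
theorem not_zHomeomorphic_of_fin_three {M N : Type*}
    [MVAlgebra M] [MVAlgebra N]
    (hM : ZHomeomorphic (dualSpace M) (cubeMul '' (dualSpace (Fin 3) ×ˢ dualSpace (Fin 3))))
    (hN : ZHomeomorphic (dualSpace N) (cubeSum '' (dualSpace (Fin 3) ×ˢ dualSpace (Fin 3)))) :
    ¬ ZHomeomorphic (dualSpace M) (dualSpace N) := by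
  rintro ⟨e, -, he⟩
  obtain ⟨eM, hM, -⟩ := hM
  obtain ⟨eN, -, hN⟩ := hN
  let s : cubeSum '' (dualSpace (Fin 3) ×ˢ dualSpace (Fin 3)) :=
    ⟨_, (finThreeEmbedding, finThreeEmbedding),
      ⟨isMVHom_finThreeEmbedding, isMVHom_finThreeEmbedding⟩, rfl⟩
  have two_int : ∃ n : ℤ, (2 : ℝ) = n := ⟨2, by norm_num⟩
  have h₀ (i) : ∃ n : ℤ, 2 * (s.1 i : ℝ) = n := by
    rcases i with i | i
    all_goals
      exact ⟨(i : ℕ), by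
        simp only [s, cubeSum, Sum.elim_inl, Sum.elim_inr, isMVHom_finThreeEmbedding.coe_fin_three]
        push_cast
        ring⟩
  have h₁ (j) : ∃ n : ℤ, 2 * ((eN.symm s).1 j : ℝ) = n := by
    obtain ⟨ξ, hξ, h⟩ := hN j
    rw [h]
    exact hξ.exists_int_eq h₀ two_int
  -- Half-integrality of coordinates is transported along each `ℤ`-map in turn, until it reaches the
  -- set of products.
  have h₂ (j) : ∃ n : ℤ, 2 * ((e.symm (eN.symm s)).1 j : ℝ) = n := by
    obtain ⟨ξ, hξ, h⟩ := he j
    rw [h]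
    exact hξ.exists_int_eq h₁ two_int
  obtain ⟨n, hn⟩ : ∃ n : ℤ, 2 * ((eM (e.symm (eN.symm s))).1 (1, 1) : ℝ) = n := by
    obtain ⟨ξ, hξ, h⟩ := hM (1, 1)
    rw [h]
    exact hξ.exists_int_eq h₂ two_int
  -- Any point of the set of products has `(1, 1)`-coordinate `1/4`, and twice that is not an
  -- integer.
  obtain ⟨⟨f, g⟩, ⟨hf, hg⟩, h⟩ := (eM (e.symm (eN.symm s))).2
  rw [← h, cubeMul, Set.Icc.coe_mul, IsMVHom.coe_fin_three (f := f) hf,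
    IsMVHom.coe_fin_three (f := g) hg] at hn
  have h4 : (1 : ℝ) = ((2 * n : ℤ) : ℝ) := by
    push_cast
    rw [← hn]
    norm_num
  have : (1 : ℤ) = 2 * n := by exact_mod_cast h4
  omega

/-! ### The duals of the tensor product and the coproducts -/

section Duals

variable (A : Type u) (B : Type v) [MVAlgebra A] [MVAlgebra B]

theorem zHomeomorphic_dualSpace_semisimpleTensor :
    ZHomeomorphic (dualSpace (SemisimpleTensor A B))
      (cubeMul '' (dualSpace A ×ˢ dualSpace B)) :=
  solutionSet_tensorRel (A := A) (B := B) ▸ zHomeomorphic_dualSpace_semisimpleQuot_presentedMV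

theorem zHomeomorphic_dualSpace_mvCoproduct :
    ZHomeomorphic (dualSpace (MVCoproduct A B)) (cubeSum '' (dualSpace A ×ˢ dualSpace B)) :=
  solutionSet_coproductRel (A := A) (B := B) ▸ zHomeomorphic_dualSpace_presentedMV

theorem zHomeomorphic_dualSpace_semisimpleCoproduct :
    ZHomeomorphic (dualSpace (SemisimpleCoproduct A B))
      (cubeSum '' (dualSpace A ×ˢ dualSpace B)) :=
  solutionSet_coproductRel (A := A) (B := B) ▸ zHomeomorphic_dualSpace_semisimpleQuot_presentedMV

end Duals

theorem mainTheorem5 :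
    (∀ (A : Type u) (B : Type v) [MVAlgebra A] [MVAlgebra B],
      IsSemisimpleMV A → IsSemisimpleMV B →
        ZHomeomorphic (dualSpace (SemisimpleTensor A B))
          (cubeMul '' (dualSpace A ×ˢ dualSpace B)) ∧
        ZHomeomorphic (dualSpace (MVCoproduct A B))
          (cubeSum '' (dualSpace A ×ˢ dualSpace B)) ∧
        ZHomeomorphic (dualSpace (SemisimpleCoproduct A B))
          (cubeSum '' (dualSpace A ×ˢ dualSpace B)) ∧
        Nonempty (dualSpace (SemisimpleTensor A B) ≃ₜ dualSpace (MVCoproduct A B)) ∧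
        Nonempty (dualSpace (SemisimpleTensor A B) ≃ₜ dualSpace (SemisimpleCoproduct A B))) ∧
    (∃ (A B : Type) (_ : MVAlgebra A) (_ : MVAlgebra B),
      Finite A ∧ Finite B ∧ IsSemisimpleMV A ∧ IsSemisimpleMV B ∧
        ¬ ZHomeomorphic (dualSpace (SemisimpleTensor A B)) (dualSpace (MVCoproduct A B)) ∧
        ¬ ZHomeomorphic (dualSpace (SemisimpleTensor A B))
            (dualSpace (SemisimpleCoproduct A B))) := by
  refine ⟨fun A B _ _ _ _ => ?_, Fin 3, Fin 3, inferInstance, inferInstance, inferInstance,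
    inferInstance, isSemisimpleMV_fin_three, isSemisimpleMV_fin_three,
    not_zHomeomorphic_of_fin_three (zHomeomorphic_dualSpace_semisimpleTensor _ _)
      (zHomeomorphic_dualSpace_mvCoproduct _ _),
    not_zHomeomorphic_of_fin_three (zHomeomorphic_dualSpace_semisimpleTensor _ _)
      (zHomeomorphic_dualSpace_semisimpleCoproduct _ _)⟩
  have hT := zHomeomorphic_dualSpace_semisimpleTensor A B
  have hC := zHomeomorphic_dualSpace_mvCoproduct A B
  have hS := zHomeomorphic_dualSpace_semisimpleCoproduct A B
  refine ⟨hT, hC, hS, ?_, ?_⟩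
  · obtain ⟨e, -⟩ := hT
    obtain ⟨e', -⟩ := hC
    exact ⟨(e.trans cubeMulHomeoCubeSum).trans e'.symm⟩
  · obtain ⟨e, -⟩ := hT
    obtain ⟨e', -⟩ := hS
    exact ⟨(e.trans cubeMulHomeoCubeSum).trans e'.symm⟩
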